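/- Let $n$ be a positive integer, $f\colon\mathbb R^n\to\mathbb R$, $b\in\mathbb R$, and for $i=1,\dots,n$ let $l_i\in\mathbb R\cup\{-\infty\}$, $u_i\in\mathbb R\cup\{+\infty\}$ with $l_i<u_i$. Consider the problem of minimizing $f$ over $$\mathcal F=\Big\{x\in\mathbb R^n:\ \sum_{i=1}^n x_i=b,\ \ l_i\le x_i\le u_i\ (i=1,\dots,n)\Big\}.$$ For $x\in\mathcal F$ put $D_h(x)=\min\{x_h-l_h,\,u_h-x_h\}\in[0,\infty]$. Fix $\tau\in(0,1)$. Let $\{x^k\}_{k\ge0}$ be produced by the Almost Cyclic 2-Coordinate Descent method with exact line search: $x^0\in\mathcal F$ and, for every $k=0,1,\dots$, one chooses an index $j(k)$ satisfying $$D_{j(k)}(x^k)\ \ge\ \tau\max_{h}D_h(x^k)\qquad(\ast)$$ and a permutation $(p^k_1,\dots,p^k_n)$ of $\{1,\dots,n\}$, sets $z^{k,1}=x^k$ and, for $i=1,\dots,n$, $$g^{k,i}=\nabla_{j(k)}f(z^{k,i})-\nabla_{p^k_i}f(z^{k,i}),\quad d^{k,i}=g^{k,i}(e_{p^k_i}-e_{j(k)}),\quad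 z^{k,i+1}=z^{k,i}+\alpha^{k,i}d^{k,i},$$ and finally $x^{k+1}=z^{k,n+1}$. Here $\alpha^{k,i}\in\operatorname{argmin}\{f(z^{k,i}+\alpha d^{k,i}):\alpha\in[0,\bar\alpha^{k,i}],\ \alpha<\infty\}$, where $\bar\alpha^{k,i}\in[0,\infty]$ is the largest feasible stepsize along $d^{k,i}$, namely $$\bar\alpha^{k,i}=\begin{cases}\frac1{g^{k,i}}\min\{u_{p^k_i}-z^{k,i}_{p^k_i},\ z^{k,i}_{j(k)}-l_{j(k)}\}&\text{if }g^{k,i}>0,\\[2pt] \frac1{|g^{k,i}|}\min\{z^{k,i}_{p^k_i}-l_{p^k_i},\ u_{j(k)}-z^{k,i}_{j(k)}\}&\text{if }g^{k,i}<0,\\[2pt] 0&\text{if }g^{k,i}=0.\end{cases}$$ Suppose moreover that there is $k_0\ge1$ such that for all $k\ge k_0$ one has $j(k)=j(k-1)$ whenever the index $j(k-1)$ satisfies $(\ast)$ at $x^k$ (that is, $D_{j(k-1)}(x^k)\ge\tau\max_hD_h(x^k)$), and $j(k)\in\operatorname{argmax}_hD_h(x^k)$ otherwise. Assume that 1. every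 $x\in\mathcal F$ with $f(x)\le f(x^0)$ has at least one component with $l_i<x_i<u_i$; 2. $f$ is strictly convex and twice continuously differentiable on $\mathbb R^n$, an optimal solution $x^*$ of $\min_{x\in\mathcal F}f(x)$ exists, and $\nabla^2f(x^*)\succ0$. Then there exist $C\in[0,1)$ and $\bar k\ge 0$ such that $$f(x^{k+1})-f(x^*)\ \le\ C\,[f(x^k)-f(x^*)]\qquad\text{for all }k\ge\bar k.$$ -/

import Mathlib

noncomputable section

namespace AC2CD

/-- The `i`-th partial derivative of `f` at `x`. -/
def partialDeriv {n : ℕ} (f : EuclideanSpace ℝ (Fin n) → ℝ) (i : Fin n)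
    (x : EuclideanSpace ℝ (Fin n)) : ℝ :=
  fderiv ℝ f x (EuclideanSpace.single i 1)

/-- The Hessian matrix of `f` at `x`: the matrix of second-order partial derivatives. -/
def hessian {n : ℕ} (f : EuclideanSpace ℝ (Fin n) → ℝ)
    (x : EuclideanSpace ℝ (Fin n)) : Matrix (Fin n) (Fin n) ℝ :=
  Matrix.of fun i h => partialDeriv (partialDeriv f h) i x

/-- The feasible set `{x : ∑ i, x i = b, l i ≤ x i ≤ u i}`; bounds may be infinite. -/
def feasibleSet {n : ℕ} (b : ℝ) (l u : Fin n → EReal) : Set (EuclideanSpace ℝ (Fin n)) :=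
  {x | ∑ i, x i = b ∧ ∀ i, l i ≤ (x i : EReal) ∧ (x i : EReal) ≤ u i}

/-- The level set of the starting point `x₀`. -/
def levelSet {n : ℕ} (f : EuclideanSpace ℝ (Fin n) → ℝ) (b : ℝ) (l u : Fin n → EReal)
    (x₀ : EuclideanSpace ℝ (Fin n)) : Set (EuclideanSpace ℝ (Fin n)) :=
  {x | x ∈ feasibleSet b l u ∧ f x ≤ f x₀}

/-- The distance of `x h` from its nearest bound, a value in `[0, ∞]` for feasible `x`. -/
def boundDist {n : ℕ} (l u : Fin n → EReal) (h : Fin n)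
    (x : EuclideanSpace ℝ (Fin n)) : EReal :=
  min ((x h : EReal) - l h) (u h - (x h : EReal))

/-- The maximum over `h` of the distances of `x h` from its nearest bound. -/
def maxBoundDist {n : ℕ} (l u : Fin n → EReal) (x : EuclideanSpace ℝ (Fin n)) : EReal :=
  ⨆ h, boundDist l u h x

/-- The index `j` is an admissible fixed index at `x` with parameter `τ`. -/
def Admissible {n : ℕ} (l u : Fin n → EReal) (τ : ℝ) (x : EuclideanSpace ℝ (Fin n))
    (j : Fin n) : Prop :=
  (τ : EReal) * maxBoundDist l u x ≤ boundDist l u j x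

/-- `g = ∇_j f(z) - ∇_p f(z)`. -/
def gradDiff {n : ℕ} (f : EuclideanSpace ℝ (Fin n) → ℝ) (p j : Fin n)
    (z : EuclideanSpace ℝ (Fin n)) : ℝ :=
  partialDeriv f j z - partialDeriv f p z

/-- The search direction `d = g (e_p - e_j)`. -/
def direction {n : ℕ} (f : EuclideanSpace ℝ (Fin n) → ℝ) (p j : Fin n)
    (z : EuclideanSpace ℝ (Fin n)) : EuclideanSpace ℝ (Fin n) :=
  gradDiff f p j z • (EuclideanSpace.single p (1 : ℝ) - EuclideanSpace.single j (1 : ℝ))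

/-- The largest feasible stepsize at `z` along the search direction (possibly infinite),
set to `0` when the direction vanishes. -/
def maxStep {n : ℕ} (f : EuclideanSpace ℝ (Fin n) → ℝ) (l u : Fin n → EReal) (p j : Fin n)
    (z : EuclideanSpace ℝ (Fin n)) : EReal :=
  if 0 < gradDiff f p j z then
    ((1 / gradDiff f p j z : ℝ) : EReal) *
      min (u p - (z p : EReal)) ((z j : EReal) - l j)
  else if gradDiff f p j z < 0 then
    ((1 / |gradDiff f p j z| : ℝ) : EReal) *
      min ((z p : EReal) - l p) (u j - (z j : EReal))
  else 0

/-- `x`, `j`, `p`, `z`, `α` form a run of the almost cyclic 2-coordinate descent method: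
`x k` are the outer iterates, `j k` the fixed indices, `p k` the permutations, `z k i` the inner
iterates (`i = 0, …, n`, from `z k 0 = x k` to `z k n = x (k + 1)`), `α k i` the stepsizes. -/
structure IsRun {n : ℕ} (f : EuclideanSpace ℝ (Fin n) → ℝ) (b : ℝ) (l u : Fin n → EReal)
    (τ : ℝ) (x : ℕ → EuclideanSpace ℝ (Fin n)) (j : ℕ → Fin n)
    (p : ℕ → Equiv.Perm (Fin n)) (z : ℕ → Fin (n + 1) → EuclideanSpace ℝ (Fin n))
    (α : ℕ → Fin n → ℝ) : Prop where
  start_feasible : x 0 ∈ feasibleSet b l u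
  index_admissible : ∀ k, Admissible l u τ (x k) (j k)
  inner_start : ∀ k, z k 0 = x k
  inner_step : ∀ k i,
    z k i.succ = z k i.castSucc + α k i • direction f (p k i) (j k) (z k i.castSucc)
  step_feasible : ∀ k (i : Fin n), z k i.succ ∈ feasibleSet b l u
  inner_end : ∀ k, x (k + 1) = z k (Fin.last n)

/-- At outer iteration `k`, the fixed index is kept if it is still admissible, and otherwise it is
an index of maximal distance from its nearest bound. -/
def StickyAt {n : ℕ} (l u : Fin n → EReal) (τ : ℝ)
    (x : ℕ → EuclideanSpace ℝ (Fin n)) (j : ℕ → Fin n) (k : ℕ) : Prop :=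
  (Admissible l u τ (x k) (j (k - 1)) → j k = j (k - 1)) ∧
  (¬ Admissible l u τ (x k) (j (k - 1)) → ∀ h, boundDist l u h (x k) ≤ boundDist l u (j k) (x k))

/-- The stepsize `a` at `z` is an exact line search:
`a ∈ argmin {f (z + t d) : 0 ≤ t ≤ maximal feasible stepsize}`. -/
def IsExactStep {n : ℕ} (f : EuclideanSpace ℝ (Fin n) → ℝ) (l u : Fin n → EReal) (p j : Fin n)
    (z : EuclideanSpace ℝ (Fin n)) (a : ℝ) : Prop :=
  (0 ≤ a ∧ (a : EReal) ≤ maxStep f l u p j z) ∧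
  ∀ t : ℝ, 0 ≤ t → (t : EReal) ≤ maxStep f l u p j z →
    f (z + a • direction f p j z) ≤ f (z + t • direction f p j z)

end AC2CD

end

/-!
The idea is that one outer iteration reduces the error by a factor as soon as it takes place near
the minimizer with the fixed index `j` off its bounds.

The steps only move along lines `z + ℝ (e_p - e_j)`. By convexity the exact line search, which
looks at the descent half-line only, minimizes `f` over the whole feasible part of the line
(`IsExactStep.isMinOn_pairLine`). If coordinate `j` is off its bounds at the new point `w`, first
order optimality on the line reads `g_p(w) (t - w_p) ≤ 0` for all `t ∈ [l_p, u_p]`, where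
`g_p = ∇_j f - ∇_p f` (`gradDiff_mul_sub_nonpos`). On the hyperplane of fixed coordinate sum these
inequalities for all `p`, at one and the same point, amount to optimality for the whole problem,
because `∇f(w) · (y - w) = -∑ p, g_p(w) (y_p - w_p)`.

Convergence: sublevel sets on the feasible set are compact, so along an ultrafilter all inner
iterates converge. Strict convexity forces the limits of consecutive inner iterates to coincide
(`IsRun.exists_tendsto_ultrafilter`). The index `j` has distance from its bounds at least `τ` times
the largest one, so an interior coordinate of the limit makes coordinate `j` interior in the limit
(`interior_of_admissible`). The coordinate inequalities then pass to the limit, which is therefore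
the minimizer (`IsRun.eventually_interior_and_mem`).

Rate: near the minimizer the gradient is strongly monotone and Lipschitz
(`exists_ball_stronglyMonotone_lipschitz`). With `Δ` the decrease of `f` over the outer iteration,
every step has length `O(√Δ)`. Each coordinate `p ≠ j` of the last point `w` is still the one
produced by its own step, so each summand of `∇f(w) · (w - x⋆)` is nonpositive up to the change of
the gradient since that step. Hence `∇f(w) · (w - x⋆) = O(√Δ ‖w - x⋆‖)`, strong monotonicity gives
`‖w - x⋆‖ = O(√Δ)`, and convexity gives `f w - f x⋆ ≤ K Δ` (`IsExactCycle.sub_le_mul_sub`), which is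
the contraction with factor `K / (1 + K)`.
-/

namespace AC2CD

open Filter Topology

/-! ### Convexity and first-order conditions -/

section Convexity

variable {E : Type*} [NormedAddCommGroup E] [NormedSpace ℝ E] {f : E → ℝ}

theorem add_fderiv_le_of_convexOn (hf : ConvexOn ℝ Set.univ f) {a : E}
    (hd : DifferentiableAt ℝ f a) (y : E) : f a + fderiv ℝ f a (y - a) ≤ f y := by
  have hline : ConvexOn ℝ Set.univ (f ∘ AffineMap.lineMap a y : ℝ → ℝ) := by
    simpa using hf.comp_affineMap (AffineMap.lineMap a y : ℝ →ᵃ[ℝ] E)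
  have hder : HasDerivAt (f ∘ AffineMap.lineMap a y : ℝ → ℝ) (fderiv ℝ f a (y - a)) 0 := by
    have h := hd.hasFDerivAt
    rw [← AffineMap.lineMap_apply_zero (k := ℝ) a y] at h
    simpa using h.comp_hasDerivAt (0 : ℝ) AffineMap.hasDerivAt_lineMap
  have := hline.le_slope_of_hasDerivAt (Set.mem_univ 0) (Set.mem_univ 1) one_pos hder
  simp [slope_def_field] at this
  simp
  linarith

theorem fderiv_nonneg_of_isMinOn {s : Set E} (hs : Convex ℝ s) {a y : E} (ha : a ∈ s)
    (hy : y ∈ s) (hd : DifferentiableAt ℝ f a) (hmin : IsMinOn f s a) :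
    0 ≤ fderiv ℝ f a (y - a) :=
  IsLocalMinOn.hasFDerivWithinAt_nonneg hmin.localize hd.hasFDerivAt.hasFDerivWithinAt
    (sub_mem_posTangentConeAt_of_segment_subset (hs.segment_subset ha hy))

/-- On a closed convex set, a strictly convex function that attains its minimum has compact
sublevel sets: it grows at least linearly away from the unique minimizer. -/
theorem isCompact_sublevel [ProperSpace E] (hf : StrictConvexOn ℝ Set.univ f)
    (hcont : Continuous f) {s : Set E} (hs : Convex ℝ s) (hcl : IsClosed s) {a : E}
    (ha : a ∈ s) (hmin : IsMinOn f s a) (c : ℝ) : IsCompact {y | y ∈ s ∧ f y ≤ c} := by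
  have hfs : StrictConvexOn ℝ s f := hf.subset (Set.subset_univ _) hs
  refine Metric.isCompact_of_isClosed_isBounded
    (hcl.inter (isClosed_le hcont continuous_const)) ?_
  have hK : IsCompact (s ∩ Metric.sphere a 1) := (isCompact_sphere a 1).inter_left hcl
  -- the growth constant is the least excess of `f` on the unit sphere around the minimizer
  obtain ⟨m, hm, hmle⟩ : ∃ m > 0, ∀ q ∈ s ∩ Metric.sphere a 1, m ≤ f q - f a := by
    rcases (s ∩ Metric.sphere a 1).eq_empty_or_nonempty with h | h
    · exact ⟨1, one_pos, by simp [h]⟩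
    · obtain ⟨q, hq, hqmin⟩ := hK.exists_isMinOn h hcont.continuousOn
      refine ⟨f q - f a, ?_, fun q' hq' => sub_le_sub_right (hqmin hq') _⟩
      rcases (isMinOn_iff.1 hmin q hq.1).lt_or_eq with hlt | heq
      · exact sub_pos.2 hlt
      · have hqm : IsMinOn f s q := fun y hy => by
          simpa [← heq] using hmin hy
        have := hfs.eq_of_isMinOn hmin hqm ha hq.1
        have h1 := hq.2
        simp [← this] at h1
  refine (Metric.isBounded_closedBall (x := a) (r := max 1 ((c - f a) / m))).subset ?_
  rintro y ⟨hy, hyc⟩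
  rw [Metric.mem_closedBall, dist_eq_norm]
  by_contra! hlt
  obtain ⟨h1, h2⟩ := max_lt_iff.1 hlt
  set r := ‖y - a‖ with hr
  have hr0 : 0 < r := one_pos.trans h1
  have hrinv : r⁻¹ ≤ 1 := inv_le_one_of_one_le₀ h1.le
  have hqs : (1 - r⁻¹) • a + r⁻¹ • y ∈ s :=
    hs ha hy (by linarith) (by positivity) (by ring)
  have hqn : (1 - r⁻¹) • a + r⁻¹ • y ∈ Metric.sphere a 1 := by
    have : (1 - r⁻¹) • a + r⁻¹ • y - a = r⁻¹ • (y - a) := by module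
    rw [mem_sphere_iff_norm, this, norm_smul, ← hr, Real.norm_of_nonneg (by positivity)]
    exact inv_mul_cancel₀ hr0.ne'
  have hq1 := hmle _ ⟨hqs, hqn⟩
  have hq2 := hf.convexOn.2 (Set.mem_univ a) (Set.mem_univ y) (by linarith : 0 ≤ 1 - r⁻¹)
    (by positivity : 0 ≤ r⁻¹) (by ring)
  simp only [smul_eq_mul] at hq2
  have hq3 : m ≤ r⁻¹ * (f y - f a) := by linarith
  rw [div_lt_iff₀ hm] at h2
  have hq4 : r * m ≤ f y - f a := by
    have := mul_le_mul_of_nonneg_left hq3 hr0.le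
    rwa [← mul_assoc, mul_inv_cancel₀ hr0.ne', one_mul] at this
  linarith

/-- If the derivative of a convex function is strongly monotone between the midpoint of a segment
and the endpoint at which the function is minimal, then the other endpoint lies above the minimum
by an amount quadratic in the length of the segment. -/
theorem sq_norm_le_sub_of_isMinOn (hf : ConvexOn ℝ Set.univ f) (hd : Differentiable ℝ f)
    {s : Set E} (hs : Convex ℝ s) {a y : E} (ha : a ∈ s) (hy : y ∈ s) (hmin : IsMinOn f s a)
    {μ : ℝ} (hμ : μ * ‖midpoint ℝ a y - a‖ ^ 2 ≤
      (fderiv ℝ f (midpoint ℝ a y) - fderiv ℝ f a) (midpoint ℝ a y - a)) :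
    μ / 4 * ‖y - a‖ ^ 2 ≤ f y - f a := by
  set q := midpoint ℝ a y with hq
  have hqs : q ∈ s := hs.midpoint_mem ha hy
  have h1 := add_fderiv_le_of_convexOn hf (hd q) y
  have h2 := fderiv_nonneg_of_isMinOn hs ha hqs (hd a) hmin
  have h3 : f a ≤ f q := hmin hqs
  have e1 : y - q = (1 / 2 : ℝ) • (y - a) := by
    rw [hq, midpoint_eq_smul_add]; simp only [invOf_eq_inv]; module
  have e2 : q - a = (1 / 2 : ℝ) • (y - a) := by
    rw [hq, midpoint_eq_smul_add]; simp only [invOf_eq_inv]; module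
  rw [e2] at h2 hμ
  rw [e1] at h1
  rw [sub_apply, norm_smul, mul_pow] at hμ
  norm_num at hμ h1 h2
  linarith

/-- Near a point at which the derivative of `f` is strictly differentiable with positive definite
derivative, the derivative of `f` is strongly monotone and Lipschitz. -/
theorem exists_ball_stronglyMonotone_lipschitz [FiniteDimensional ℝ E] {a : E}
    {A : E →L[ℝ] E →L[ℝ] ℝ} (hA : HasStrictFDerivAt (fderiv ℝ f) A a)
    (hpos : ∀ v ≠ 0, 0 < A v v) :
    ∃ μ > 0, ∃ M ≥ 0, ∃ r > 0, ∀ y ∈ Metric.ball a r, ∀ w ∈ Metric.ball a r,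
      μ * ‖y - w‖ ^ 2 ≤ (fderiv ℝ f y - fderiv ℝ f w) (y - w) ∧
      ‖fderiv ℝ f y - fderiv ℝ f w‖ ≤ M * ‖y - w‖ := by
  obtain ⟨m, hm, hmle⟩ : ∃ m > 0, ∀ v, m * ‖v‖ ^ 2 ≤ A v v := by
    have : ProperSpace E := FiniteDimensional.proper ℝ E
    rcases (Metric.sphere (0 : E) 1).eq_empty_or_nonempty with h | h
    · refine ⟨1, one_pos, fun v => ?_⟩
      by_cases hv : v = 0
      · simp [hv]
      · have : ‖v‖⁻¹ • v ∈ Metric.sphere (0 : E) 1 := by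
          simp [norm_smul, hv]
        simp [h] at this
    · obtain ⟨q, hq, hqmin⟩ := (isCompact_sphere (0 : E) 1).exists_isMinOn h
        (f := fun v => A v v) (by fun_prop)
      have hq0 : q ≠ 0 := by rintro rfl; simp at hq
      refine ⟨A q q, hpos q hq0, fun v => ?_⟩
      by_cases hv : v = 0
      · simp [hv]
      · have hvn : 0 < ‖v‖ := norm_pos_iff.2 hv
        have h1 : ‖v‖⁻¹ • v ∈ Metric.sphere (0 : E) 1 := by simp [norm_smul, hv]
        have h2 : A q q ≤ A (‖v‖⁻¹ • v) (‖v‖⁻¹ • v) := hqmin h1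
        simp only [map_smul, smul_eq_mul, smul_apply] at h2
        calc A q q * ‖v‖ ^ 2 ≤ (‖v‖⁻¹ * (‖v‖⁻¹ * A v v)) * ‖v‖ ^ 2 := by gcongr
          _ = A v v := by field_simp
  obtain ⟨r, hr, ho⟩ := Metric.eventually_nhds_iff.1 (hA.isLittleO.def (half_pos hm))
  refine ⟨m / 2, half_pos hm, ‖A‖ + m / 2, by positivity, r, hr, fun y hy w hw => ?_⟩
  have h := ho (y := (y, w)) (by simpa [Prod.dist_eq] using And.intro hy hw)
  simp only at h
  set D := fderiv ℝ f y - fderiv ℝ f w with hD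
  constructor
  · have h1 : |(D - A (y - w)) (y - w)| ≤ m / 2 * ‖y - w‖ * ‖y - w‖ :=
      ((D - A (y - w)).le_opNorm (y - w)).trans (by gcongr)
    rw [sub_apply] at h1
    have h2 := (abs_le.1 h1).1
    have h3 := hmle (y - w)
    nlinarith
  · calc ‖D‖ = ‖A (y - w) + (D - A (y - w))‖ := by congr 1; abel
      _ ≤ ‖A (y - w)‖ + ‖D - A (y - w)‖ := norm_add_le _ _
      _ ≤ ‖A‖ * ‖y - w‖ + m / 2 * ‖y - w‖ := add_le_add (A.le_opNorm _) h
      _ = (‖A‖ + m / 2) * ‖y - w‖ := by ring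

end Convexity

/-! ### Feasible set and partial derivatives -/

section Feasible

variable {n : ℕ} {f : EuclideanSpace ℝ (Fin n) → ℝ} {b : ℝ} {l u : Fin n → EReal}

theorem convex_feasibleSet : Convex ℝ (feasibleSet b l u) := by
  intro a ha c hc s t hs ht hst
  refine ⟨?_, fun i => ?_⟩
  · simp only [PiLp.add_apply, PiLp.smul_apply, smul_eq_mul, Finset.sum_add_distrib,
      ← Finset.mul_sum, ha.1, hc.1]
    rw [← add_mul, hst, one_mul]
  · have hconv : Convex ℝ {r : ℝ | l i ≤ (r : EReal) ∧ (r : EReal) ≤ u i} := by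
      refine Set.OrdConnected.convex ⟨fun r hr q hq w hw => ⟨hr.1.trans ?_, le_trans ?_ hq.2⟩⟩
      · exact EReal.coe_le_coe_iff.2 hw.1
      · exact EReal.coe_le_coe_iff.2 hw.2
    exact hconv (ha.2 i) (hc.2 i) hs ht hst

theorem isClosed_feasibleSet : IsClosed (feasibleSet b l u) := by
  have hc : ∀ i, Continuous fun y : EuclideanSpace ℝ (Fin n) => ((y i : ℝ) : EReal) := fun i =>
    continuous_coe_real_ereal.comp (by fun_prop)
  simp only [feasibleSet, Set.ofPred_and, Set.ofPred_forall]
  exact (isClosed_eq (by fun_prop) continuous_const).inter (isClosed_iInter fun i =>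
    (isClosed_le continuous_const (hc i)).inter (isClosed_le (hc i) continuous_const))

/-- Along the line `z + ℝ (e_p - e_j)` the directional derivative is `-gradDiff f p j`. -/
theorem fderiv_single_sub_single (p j : Fin n) (y : EuclideanSpace ℝ (Fin n)) :
    fderiv ℝ f y (EuclideanSpace.single p (1 : ℝ) - EuclideanSpace.single j (1 : ℝ)) =
      -gradDiff f p j y := by
  simp [gradDiff, partialDeriv]

/-- On vectors with zero coordinate sum, the derivative of `f` only sees the differences of the
partial derivatives with a fixed one. -/
theorem fderiv_apply_of_sum_eq_zero (j : Fin n) (y v : EuclideanSpace ℝ (Fin n))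
    (hv : ∑ i, v i = 0) : fderiv ℝ f y v = -∑ h, gradDiff f h j y * v h := by
  have hsum : v = ∑ h, v h • EuclideanSpace.single h (1 : ℝ) := by
    simpa using ((EuclideanSpace.basisFun (Fin n) ℝ).sum_repr v).symm
  have h1 : fderiv ℝ f y v = ∑ h, v h * partialDeriv f h y := by
    conv_lhs => rw [hsum]
    simp [partialDeriv]
  simp only [gradDiff, sub_mul, Finset.sum_sub_distrib, ← Finset.mul_sum, hv, h1]
  simp [mul_comm]

theorem continuous_gradDiff (hf : ContDiff ℝ 2 f) (p j : Fin n) :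
    Continuous (gradDiff f p j) := by
  have h := hf.continuous_fderiv (by norm_num)
  unfold gradDiff partialDeriv
  fun_prop

theorem abs_gradDiff_sub_le {M : ℝ} {y w : EuclideanSpace ℝ (Fin n)}
    (h : ‖fderiv ℝ f y - fderiv ℝ f w‖ ≤ M) (p j : Fin n) :
    |gradDiff f p j y - gradDiff f p j w| ≤ M * 2 := by
  have e : gradDiff f p j y - gradDiff f p j w = (fderiv ℝ f y - fderiv ℝ f w)
      (EuclideanSpace.single j (1 : ℝ) - EuclideanSpace.single p (1 : ℝ)) := by
    simp [gradDiff, partialDeriv]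
  rw [e, ← Real.norm_eq_abs]
  refine (ContinuousLinearMap.le_of_opNorm_le _ h _).trans ?_
  have hM : 0 ≤ M := (norm_nonneg _).trans h
  gcongr
  refine (norm_sub_le _ _).trans ?_
  norm_num

/-- The derivative of `fderiv ℝ f` at a point with positive definite Hessian matrix is a positive
definite bilinear form. -/
theorem fderiv_fderiv_pos_of_posDef (hf : ContDiff ℝ 2 f) {a : EuclideanSpace ℝ (Fin n)}
    (ha : (hessian f a).PosDef) {v : EuclideanSpace ℝ (Fin n)} (hv : v ≠ 0) :
    0 < fderiv ℝ (fderiv ℝ f) a v v := by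
  have hd : DifferentiableAt ℝ (fderiv ℝ f) a :=
    (hf.contDiffAt.fderiv_right (m := 1) (by norm_num)).differentiableAt (by norm_num)
  have hH : ∀ i h, hessian f a i h = fderiv ℝ (fderiv ℝ f) a
      (EuclideanSpace.single i (1 : ℝ)) (EuclideanSpace.single h (1 : ℝ)) := by
    intro i h
    have : HasFDerivAt (partialDeriv f h)
        ((fderiv ℝ (fderiv ℝ f) a).flip (EuclideanSpace.single h (1 : ℝ))) a := by
      unfold partialDeriv
      exact hd.hasFDerivAt.clm_apply (hasFDerivAt_const _ a) |>.congr_fderiv (by ext; simp)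
    rw [hessian, Matrix.of_apply, partialDeriv, this.fderiv]
    rfl
  have hsum : v = ∑ h, v h • EuclideanSpace.single h (1 : ℝ) := by
    simpa using ((EuclideanSpace.basisFun (Fin n) ℝ).sum_repr v).symm
  have hpos := ha.dotProduct_mulVec_pos (x := v.ofLp) (by simpa using hv)
  have hexp : fderiv ℝ (fderiv ℝ f) a v v = star v.ofLp ⬝ᵥ (hessian f a).mulVec v.ofLp := by
    conv_lhs => rw [hsum]
    simp [Matrix.mulVec, dotProduct, hH, Finset.mul_sum, sum_apply, mul_comm]
    rw [Finset.sum_comm]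
    simp only [mul_left_comm]
  rwa [hexp]

end Feasible

/-! ### Exact line search steps -/

section Step

variable {n : ℕ} {f : EuclideanSpace ℝ (Fin n) → ℝ} {b : ℝ} {l u : Fin n → EReal}

/-- The feasible points on the line through `z` in the direction `e_p - e_j`. -/
def pairLine (b : ℝ) (l u : Fin n → EReal) (p j : Fin n) (z : EuclideanSpace ℝ (Fin n)) :
    Set (EuclideanSpace ℝ (Fin n)) :=
  {y | y ∈ feasibleSet b l u ∧ ∃ s : ℝ,
    y = z + s • (EuclideanSpace.single p (1 : ℝ) - EuclideanSpace.single j (1 : ℝ))}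

theorem self_mem_pairLine {p j : Fin n} {z : EuclideanSpace ℝ (Fin n)}
    (hz : z ∈ feasibleSet b l u) : z ∈ pairLine b l u p j z :=
  ⟨hz, 0, by simp⟩

theorem convex_pairLine (p j : Fin n) (z : EuclideanSpace ℝ (Fin n)) :
    Convex ℝ (pairLine b l u p j z) := by
  rintro a ⟨ha, s, hs⟩ c ⟨hc, t, ht⟩ θ κ hθ hκ hsum
  refine ⟨convex_feasibleSet ha hc hθ hκ hsum, θ * s + κ * t, ?_⟩
  obtain rfl : κ = 1 - θ := by linarith
  rw [hs, ht]
  module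

/-- The feasibility of a point bounds the step leading to it by the distances to the bounds. -/
theorem le_min_of_mem_feasibleSet {p j : Fin n} (hpj : p ≠ j) {z : EuclideanSpace ℝ (Fin n)}
    {s : ℝ} (hy : z + s • (EuclideanSpace.single p (1 : ℝ) - EuclideanSpace.single j (1 : ℝ)) ∈
      feasibleSet b l u) :
    (s : EReal) ≤ min (u p - (z p : EReal)) ((z j : EReal) - l j) := by
  have hp := (hy.2 p).2
  have hj := (hy.2 j).1
  simp only [PiLp.add_apply, PiLp.smul_apply, PiLp.sub_apply, PiLp.single_apply,
    if_neg hpj, if_neg hpj.symm, if_true, smul_eq_mul] at hp hj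
  rw [sub_zero, mul_one, add_comm, EReal.coe_add] at hp
  rw [zero_sub, mul_neg_one, ← sub_eq_add_neg, EReal.coe_sub,
    EReal.le_sub_iff_add_le (.inl (EReal.coe_ne_bot _)) (.inl (EReal.coe_ne_top _)),
    add_comm] at hj
  exact le_min
    ((EReal.le_sub_iff_add_le (.inl (EReal.coe_ne_bot _)) (.inl (EReal.coe_ne_top _))).2 hp)
    ((EReal.le_sub_iff_add_le (.inr (EReal.coe_ne_bot _)) (.inr (EReal.coe_ne_top _))).2 hj)

theorem coe_div_le_one_div_mul {g s : ℝ} (hg : 0 < g) {m : EReal} (h : (s : EReal) ≤ m) :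
    ((s / g : ℝ) : EReal) ≤ ((1 / g : ℝ) : EReal) * m := by
  have : ((s / g : ℝ) : EReal) = ((1 / g : ℝ) : EReal) * (s : EReal) := by
    rw [← EReal.coe_mul]; congr 1; ring
  rw [this]
  exact mul_le_mul_of_nonneg_left h (EReal.coe_nonneg.2 (by positivity))

/-- The exact line search, although restricted to the descent half-line, minimizes a convex
function over all feasible points of the line: the other half-line is uphill. -/
theorem IsExactStep.isMinOn_pairLine (hf : ConvexOn ℝ Set.univ f) (hd : Differentiable ℝ f)
    {p j : Fin n} {z : EuclideanSpace ℝ (Fin n)} {a : ℝ} (h : IsExactStep f l u p j z a) :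
    IsMinOn f (pairLine b l u p j z) (z + a • direction f p j z) := by
  rintro y ⟨hy, s, rfl⟩
  change f _ ≤ f _
  obtain ⟨⟨ha0, haM⟩, hmin⟩ := h
  have hdesc : f (z + a • direction f p j z) ≤ f z := by
    simpa using hmin 0 le_rfl (le_trans (by exact_mod_cast ha0) haM)
  have hup : 0 ≤ s * -gradDiff f p j z → f (z + a • direction f p j z) ≤
      f (z + s • (EuclideanSpace.single p (1 : ℝ) - EuclideanSpace.single j (1 : ℝ))) := by
    intro hs
    have h1 := add_fderiv_le_of_convexOn hf (hd z)
      (z + s • (EuclideanSpace.single p (1 : ℝ) - EuclideanSpace.single j (1 : ℝ)))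
    rw [add_sub_cancel_left, map_smul, fderiv_single_sub_single, smul_eq_mul] at h1
    linarith
  rcases le_or_gt 0 (s * -gradDiff f p j z) with hs | hs
  · exact hup hs
  have hg0 : gradDiff f p j z ≠ 0 := by rintro h0; simp [h0] at hs
  have hpj : p ≠ j := by rintro rfl; simp [gradDiff] at hg0
  have hdir : (s / gradDiff f p j z) • direction f p j z =
      s • (EuclideanSpace.single p (1 : ℝ) - EuclideanSpace.single j (1 : ℝ)) := by
    rw [direction, smul_smul, div_mul_cancel₀ _ hg0]
  rw [← hdir]
  rcases lt_or_gt_of_ne hg0 with hg | hg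
  · have hs0 : s < 0 := by nlinarith
    refine hmin _ (div_nonneg_of_nonpos hs0.le hg.le) ?_
    rw [maxStep, if_neg hg.not_gt, if_pos hg, ← neg_div_neg_eq, ← abs_of_neg hg]
    refine coe_div_le_one_div_mul (abs_pos.2 hg0) ?_
    rw [min_comm]
    refine le_min_of_mem_feasibleSet (b := b) hpj.symm ?_
    convert hy using 2
    module
  · have hs0 : 0 < s := by nlinarith
    refine hmin _ (by positivity) ?_
    rw [maxStep, if_pos hg]
    exact coe_div_le_one_div_mul hg (le_min_of_mem_feasibleSet hpj hy)

/-- Optimality of a minimizer `w` on the feasible line through it, when the coordinate `j` of `w`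
is off its bounds: then only the bounds of the coordinate `p` matter. -/
theorem gradDiff_mul_sub_nonpos (hd : Differentiable ℝ f) {p j : Fin n}
    {w : EuclideanSpace ℝ (Fin n)} (hw : w ∈ feasibleSet b l u)
    (hmin : IsMinOn f (pairLine b l u p j w) w)
    (hlj : l j < (w j : EReal)) (huj : (w j : EReal) < u j)
    {t : ℝ} (hlt : l p ≤ (t : EReal)) (htu : (t : EReal) ≤ u p) :
    gradDiff f p j w * (t - w p) ≤ 0 := by
  by_cases hpj : p = j
  · simp [gradDiff, hpj]
  have hev : ∀ᶠ ε : ℝ in 𝓝[>] 0,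
      ((w j - ε * (t - w p) : ℝ) : EReal) ∈ Set.Ioo (l j) (u j) := by
    have hc : Continuous fun ε : ℝ => ((w j - ε * (t - w p) : ℝ) : EReal) :=
      continuous_coe_real_ereal.comp (by fun_prop)
    refine (hc.tendsto 0).mono_left nhdsWithin_le_nhds (isOpen_Ioo.mem_nhds ?_)
    simpa using And.intro hlj huj
  obtain ⟨ε, ⟨hε1, hε2⟩, hε0, hε⟩ :=
    (hev.and (Ioo_mem_nhdsGT (one_pos : (0 : ℝ) < 1))).exists
  set q := w + (ε * (t - w p)) •
    (EuclideanSpace.single p (1 : ℝ) - EuclideanSpace.single j (1 : ℝ)) with hq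
  have hqF : q ∈ feasibleSet b l u := by
    refine ⟨?_, fun i => ?_⟩
    · have hw1 := hw.1
      simp only [hq, PiLp.add_apply, PiLp.smul_apply, PiLp.sub_apply, smul_eq_mul,
        Finset.sum_add_distrib, ← Finset.mul_sum, Finset.sum_sub_distrib, hw1]
      simp
    · by_cases hip : i = p
      · subst hip
        have e : q i = w i + ε * (t - w i) := by simp [hq, hpj]
        rw [e]
        rcases le_total (w i) t with hle | hle
        · exact ⟨(hw.2 i).1.trans (EReal.coe_le_coe_iff.2 (by nlinarith)),
            le_trans (EReal.coe_le_coe_iff.2 (by nlinarith)) htu⟩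
        · exact ⟨hlt.trans (EReal.coe_le_coe_iff.2 (by nlinarith)),
            le_trans (EReal.coe_le_coe_iff.2 (by nlinarith)) (hw.2 i).2⟩
      · by_cases hij : i = j
        · subst hij
          have e : q i = w i - ε * (t - w p) := by simp [hq, hip]; ring
          rw [e]
          exact ⟨hε1.le, hε2.le⟩
        · have e : q i = w i := by simp [hq, hip, hij]
          rw [e]
          exact hw.2 i
  have h := fderiv_nonneg_of_isMinOn (convex_pairLine p j w) (self_mem_pairLine hw)
    (⟨hqF, _, hq⟩ : q ∈ pairLine b l u p j w) (hd w) hmin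
  rw [hq, add_sub_cancel_left, map_smul, fderiv_single_sub_single, smul_eq_mul] at h
  nlinarith

/-- The points of a feasible line span the same feasible line. -/
theorem pairLine_eq_of_mem {p j : Fin n} {z w : EuclideanSpace ℝ (Fin n)}
    (hw : w ∈ pairLine b l u p j z) : pairLine b l u p j w = pairLine b l u p j z := by
  obtain ⟨-, s, rfl⟩ := hw
  ext y
  refine and_congr_right fun _ => ⟨fun ⟨t, ht⟩ => ⟨s + t, ?_⟩, fun ⟨t, ht⟩ => ⟨t - s, ?_⟩⟩
  · rw [ht]; module
  · rw [ht]; module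

end Step

/-! ### One outer iteration -/

section Cycle

variable {n : ℕ} {f : EuclideanSpace ℝ (Fin n) → ℝ} {b : ℝ} {l u : Fin n → EReal}
  {j : Fin n} {p : Equiv.Perm (Fin n)} {z : Fin (n + 1) → EuclideanSpace ℝ (Fin n)}

/-- The inner iterates `z 0, …, z n` of one outer iteration with fixed index `j` and
permutation `p`: each step moves to a minimizer of `f` over the whole feasible line. -/
structure IsExactCycle (f : EuclideanSpace ℝ (Fin n) → ℝ) (b : ℝ) (l u : Fin n → EReal)
    (j : Fin n) (p : Equiv.Perm (Fin n)) (z : Fin (n + 1) → EuclideanSpace ℝ (Fin n)) :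
    Prop where
  mem : ∀ m, z m ∈ feasibleSet b l u
  step_mem : ∀ i : Fin n, z i.succ ∈ pairLine b l u (p i) j (z i.castSucc)
  step_min : ∀ i : Fin n, IsMinOn f (pairLine b l u (p i) j (z i.castSucc)) (z i.succ)

namespace IsExactCycle

theorem antitone (h : IsExactCycle f b l u j p z) : Antitone fun m => f (z m) :=
  Fin.antitone_iff_succ_le.2 fun i => h.step_min i (self_mem_pairLine (h.mem _))

theorem isMinOn_pairLine_succ (h : IsExactCycle f b l u j p z) (i : Fin n) :
    IsMinOn f (pairLine b l u (p i) j (z i.succ)) (z i.succ) := by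
  rw [pairLine_eq_of_mem (h.step_mem i)]
  exact h.step_min i

theorem gradDiff_succ_mul_sub_nonpos (h : IsExactCycle f b l u j p z) (hd : Differentiable ℝ f)
    (hj : ∀ m, l j < (z m j : EReal) ∧ (z m j : EReal) < u j) (i : Fin n) {t : ℝ}
    (hlt : l (p i) ≤ (t : EReal)) (htu : (t : EReal) ≤ u (p i)) :
    gradDiff f (p i) j (z i.succ) * (t - z i.succ (p i)) ≤ 0 :=
  gradDiff_mul_sub_nonpos hd (h.mem _) (h.isMinOn_pairLine_succ i) (hj _).1 (hj _).2 hlt htu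

/-- A coordinate other than `j` is not touched after its own step. -/
theorem last_apply (h : IsExactCycle f b l u j p z) {i : Fin n} (hi : p i ≠ j) :
    z (Fin.last n) (p i) = z i.succ (p i) := by
  have key : ∀ m : Fin (n + 1), i.succ ≤ m → z m (p i) = z i.succ (p i) := by
    intro m
    induction m using Fin.induction with
    | zero => intro hm; exact absurd hm (by simp)
    | succ q ih =>
      intro hm
      rcases hm.eq_or_lt with he | hlt
      · rw [he]
      · have hiq : i < q := Fin.succ_lt_succ_iff.1 hlt
        obtain ⟨-, s, hs⟩ := h.step_mem q
        have hne : p i ≠ p q := fun e => hiq.ne (p.injective e)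
        rw [← ih (by simpa [Fin.le_def] using hiq), hs]
        simp [hne, hi]
  exact key _ (Fin.le_last _)

theorem norm_sub_zero_le (z : Fin (n + 1) → EuclideanSpace ℝ (Fin n)) {B : ℝ}
    (hB : ∀ i : Fin n, ‖z i.succ - z i.castSucc‖ ≤ B) (m : Fin (n + 1)) :
    ‖z m - z 0‖ ≤ m * B := by
  induction m using Fin.induction with
  | zero => simp
  | succ i ih =>
    calc ‖z i.succ - z 0‖ ≤ ‖z i.succ - z i.castSucc‖ + ‖z i.castSucc - z 0‖ :=
          norm_sub_le_norm_sub_add_norm_sub _ _ _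
      _ ≤ B + (i.castSucc : ℕ) * B := add_le_add (hB i) ih
      _ = (i.succ : ℕ) * B := by simp; ring

/-- Contraction of the error over one outer iteration that stays in a ball where the derivative of
`f` is strongly monotone and Lipschitz and keeps the coordinate `j` off its bounds. The step
lengths are controlled by the decrease of `f`, and the final error by the step lengths. -/
theorem sub_le_mul_sub (h : IsExactCycle f b l u j p z) (hf : ConvexOn ℝ Set.univ f)
    (hd : Differentiable ℝ f) {xs : EuclideanSpace ℝ (Fin n)} (hxs : xs ∈ feasibleSet b l u)
    (hmin : IsMinOn f (feasibleSet b l u) xs) {μ M r : ℝ} (hμ : 0 < μ) (hM : 0 ≤ M)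
    (hball : ∀ y ∈ Metric.ball xs r, ∀ w ∈ Metric.ball xs r,
      μ * ‖y - w‖ ^ 2 ≤ (fderiv ℝ f y - fderiv ℝ f w) (y - w) ∧
      ‖fderiv ℝ f y - fderiv ℝ f w‖ ≤ M * ‖y - w‖)
    (hz : ∀ m, z m ∈ Metric.ball xs r)
    (hj : ∀ m, l j < (z m j : EReal) ∧ (z m j : EReal) < u j) :
    f (z (Fin.last n)) - f xs ≤
      (4 * n ^ 2 * M) ^ 2 * 4 / μ ^ 2 * (f (z 0) - f (z (Fin.last n))) := by
  set w := z (Fin.last n) with hw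
  set Δ := f (z 0) - f w with hΔ
  have hr : 0 < r := Metric.pos_of_mem_ball (hz 0)
  have hΔ0 : 0 ≤ Δ := sub_nonneg.2 (h.antitone (Fin.zero_le _))
  have hsq : ∀ i : Fin n, ‖z i.succ - z i.castSucc‖ ≤ √(4 * Δ / μ) := by
    intro i
    apply Real.le_sqrt_of_sq_le
    have h1 := sq_norm_le_sub_of_isMinOn hf hd (convex_pairLine _ _ _) (h.step_mem i)
      (self_mem_pairLine (h.mem _)) (h.step_min i)
      (hball _ ((convex_ball xs r).midpoint_mem (hz _) (hz _)) _ (hz _)).1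
    have h2 : f (z i.castSucc) ≤ f (z 0) := h.antitone (Fin.zero_le _)
    have h3 : f w ≤ f (z i.succ) := h.antitone (Fin.le_last _)
    rw [norm_sub_rev, le_div_iff₀ hμ]
    linarith
  set B := √(4 * Δ / μ) with hB
  have hB0 : 0 ≤ B := Real.sqrt_nonneg _
  have hBsq : B ^ 2 = 4 * Δ / μ := Real.sq_sqrt (by positivity)
  have hdist : ∀ m, ‖z m - w‖ ≤ 2 * n * B := by
    intro m
    have hm : ((m : ℕ) : ℝ) ≤ n := by exact_mod_cast Nat.lt_succ_iff.1 m.2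
    have h1 := norm_sub_zero_le z hsq m
    have h2 := norm_sub_zero_le z hsq (Fin.last n)
    calc ‖z m - w‖ ≤ ‖z m - z 0‖ + ‖z 0 - w‖ := norm_sub_le_norm_sub_add_norm_sub _ _ _
      _ ≤ m * B + n * B := add_le_add h1 (by rw [norm_sub_rev]; simpa using h2)
      _ ≤ n * B + n * B := by gcongr
      _ = 2 * n * B := by ring
  -- each summand of `∇f(w) · (w - xs)` has the favourable sign at the end of its own step
  have hterm : ∀ q : Fin n, gradDiff f q j w * (xs q - w q) ≤ M * (2 * n * B) * 2 * ‖w - xs‖ := by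
    intro q
    by_cases hq : q = j
    · rw [show gradDiff f q j w = 0 by simp [gradDiff, hq], zero_mul]
      positivity
    obtain ⟨i, rfl⟩ := p.surjective q
    have h1 := h.gradDiff_succ_mul_sub_nonpos hd hj i (hxs.2 _).1 (hxs.2 _).2
    rw [← h.last_apply hq, ← hw] at h1
    have h2 : |gradDiff f (p i) j w - gradDiff f (p i) j (z i.succ)| ≤ M * (2 * n * B) * 2 := by
      refine abs_gradDiff_sub_le ((hball _ (hz _) _ (hz _)).2.trans ?_) _ _
      rw [norm_sub_rev]
      exact mul_le_mul_of_nonneg_left (hdist _) hM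
    have h3 : |xs (p i) - w (p i)| ≤ ‖w - xs‖ := by
      rw [norm_sub_rev]
      exact PiLp.norm_apply_le (xs - w) (p i)
    have h4 : (gradDiff f (p i) j w - gradDiff f (p i) j (z i.succ)) * (xs (p i) - w (p i)) ≤
        M * (2 * n * B) * 2 * ‖w - xs‖ := by
      refine (le_abs_self _).trans ?_
      rw [abs_mul]
      exact mul_le_mul h2 h3 (abs_nonneg _) (by positivity)
    linarith
  have hgrad : fderiv ℝ f w (w - xs) ≤ 4 * n ^ 2 * M * B * ‖w - xs‖ := by
    have hs : ∑ i, (xs - w) i = 0 := by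
      simp only [PiLp.sub_apply, Finset.sum_sub_distrib, hxs.1, (h.mem (Fin.last n)).1, hw,
        sub_self]
    have h1 := fderiv_apply_of_sum_eq_zero (f := f) j w _ hs
    have h2 : ∑ q, gradDiff f q j w * (xs - w) q ≤
        ∑ _q : Fin n, M * (2 * n * B) * 2 * ‖w - xs‖ :=
      Finset.sum_le_sum fun q _ => hterm q
    rw [← neg_sub w xs, map_neg, neg_inj, neg_sub] at h1
    rw [h1]
    refine h2.trans_eq ?_
    simp
    ring
  have hopt := fderiv_nonneg_of_isMinOn convex_feasibleSet hxs (h.mem (Fin.last n)) (hd xs) hmin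
  have hmono := (hball w (hz _) xs (Metric.mem_ball_self hr)).1
  rw [sub_apply] at hmono
  have hval := add_fderiv_le_of_convexOn hf (hd w) xs
  rw [← neg_sub w xs, map_neg] at hval
  set c : ℝ := 4 * n ^ 2 * M with hc
  have hc0 : 0 ≤ c := by positivity
  have hnorm : ‖w - xs‖ ≤ c * B / μ := by
    rw [le_div_iff₀ hμ]
    rcases (norm_nonneg (w - xs)).eq_or_lt with h0 | h0
    · rw [← h0]; nlinarith
    · refine le_of_mul_le_mul_right ?_ h0
      nlinarith
  calc f w - f xs ≤ c * B * ‖w - xs‖ := by linarith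
    _ ≤ c * B * (c * B / μ) := by gcongr
    _ = c ^ 2 * B ^ 2 / μ := by ring
    _ = c ^ 2 * 4 / μ ^ 2 * Δ := by rw [hBsq]; field_simp

end IsExactCycle

end Cycle

/-! ### Convergence of the iterates -/

section Run

variable {n : ℕ} {f : EuclideanSpace ℝ (Fin n) → ℝ} {b τ : ℝ} {l u : Fin n → EReal}
  {x : ℕ → EuclideanSpace ℝ (Fin n)} {j : ℕ → Fin n} {p : ℕ → Equiv.Perm (Fin n)}
  {z : ℕ → Fin (n + 1) → EuclideanSpace ℝ (Fin n)} {α : ℕ → Fin n → ℝ}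

theorem coe_le_boundDist_iff {h : Fin n} {y : EuclideanSpace ℝ (Fin n)} {d : ℝ} :
    (d : EReal) ≤ boundDist l u h y ↔
      l h ≤ ((y h - d : ℝ) : EReal) ∧ ((y h + d : ℝ) : EReal) ≤ u h := by
  rw [boundDist, le_min_iff,
    EReal.le_sub_iff_add_le (.inr (EReal.coe_ne_bot _)) (.inr (EReal.coe_ne_top _)),
    EReal.le_sub_iff_add_le (.inl (EReal.coe_ne_bot _)) (.inl (EReal.coe_ne_top _)),
    EReal.coe_sub, EReal.coe_add,
    EReal.le_sub_iff_add_le (.inl (EReal.coe_ne_bot _)) (.inl (EReal.coe_ne_top _)),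
    add_comm (d : EReal) (l h), add_comm (d : EReal) (y h : EReal)]

theorem IsRun.mem_feasibleSet (hrun : IsRun f b l u τ x j p z α) (k : ℕ) (m : Fin (n + 1)) :
    z k m ∈ feasibleSet b l u := by
  have hx : ∀ k, x k ∈ feasibleSet b l u → ∀ m, z k m ∈ feasibleSet b l u := by
    intro k hk m
    cases m using Fin.cases with
    | zero => rwa [hrun.inner_start]
    | succ i => exact hrun.step_feasible k i
  have hall : ∀ k, x k ∈ feasibleSet b l u := by
    intro k
    induction k with
    | zero => exact hrun.start_feasible
    | succ k ih => rw [hrun.inner_end]; exact hx k ih _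
  exact hx k (hall k) m

theorem IsRun.isExactCycle (hrun : IsRun f b l u τ x j p z α)
    (hexact : ∀ k i, IsExactStep f l u (p k i) (j k) (z k i.castSucc) (α k i))
    (hf : ConvexOn ℝ Set.univ f) (hd : Differentiable ℝ f) (k : ℕ) :
    IsExactCycle f b l u (j k) (p k) (z k) where
  mem := hrun.mem_feasibleSet k
  step_mem i := by
    refine ⟨hrun.mem_feasibleSet k _, α k i * gradDiff f (p k i) (j k) (z k i.castSucc), ?_⟩
    rw [hrun.inner_step, direction, smul_smul]
  step_min i := by
    rw [hrun.inner_step]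
    exact (hexact k i).isMinOn_pairLine hf hd

theorem IsRun.antitone (hrun : IsRun f b l u τ x j p z α)
    (hcyc : ∀ k, IsExactCycle f b l u (j k) (p k) (z k)) : Antitone fun k => f (x k) :=
  antitone_nat_of_succ_le fun k => by
    rw [hrun.inner_end, ← hrun.inner_start]
    exact (hcyc k).antitone (Fin.zero_le _)

theorem IsRun.mem_levelSet (hrun : IsRun f b l u τ x j p z α)
    (hcyc : ∀ k, IsExactCycle f b l u (j k) (p k) (z k)) (k : ℕ) (m : Fin (n + 1)) :
    z k m ∈ levelSet f b l u (x 0) :=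
  ⟨(hcyc k).mem m, ((hcyc k).antitone (Fin.zero_le m)).trans
    (by simpa [hrun.inner_start] using hrun.antitone hcyc (Nat.zero_le k))⟩

/-- All inner iterates have objective values with a common limit. -/
theorem IsRun.exists_tendsto (hrun : IsRun f b l u τ x j p z α)
    (hcyc : ∀ k, IsExactCycle f b l u (j k) (p k) (z k)) {c : ℝ} (hc : ∀ k, c ≤ f (x k)) :
    ∃ v, ∀ m, Tendsto (fun k => f (z k m)) atTop (𝓝 v) := by
  obtain ⟨v, hv⟩ : ∃ v, Tendsto (fun k => f (x k)) atTop (𝓝 v) :=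
    ⟨_, tendsto_atTop_ciInf (hrun.antitone hcyc) ⟨c, by rintro _ ⟨k, rfl⟩; exact hc k⟩⟩
  refine ⟨v, fun m => tendsto_of_tendsto_of_tendsto_of_le_of_le
    (hv.comp (tendsto_add_atTop_nat 1)) hv (fun k => ?_) fun k => ?_⟩
  · simp only [Function.comp, hrun.inner_end]
    exact (hcyc k).antitone (Fin.le_last m)
  · rw [← hrun.inner_start]
    exact (hcyc k).antitone (Fin.zero_le m)

/-- Along an ultrafilter all inner iterates share one limit: two consecutive limits have the same
value, and the later one minimizes `f` on the segment between them, so they agree by strict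
convexity. -/
theorem IsRun.exists_tendsto_ultrafilter (hrun : IsRun f b l u τ x j p z α)
    (hcyc : ∀ k, IsExactCycle f b l u (j k) (p k) (z k))
    (hf : StrictConvexOn ℝ Set.univ f) (hcont : Continuous f)
    (hcpt : IsCompact (levelSet f b l u (x 0))) (U : Ultrafilter ℕ) {v : ℝ}
    (hv : ∀ m, Tendsto (fun k => f (z k m)) U (𝓝 v)) :
    ∃ y ∈ levelSet f b l u (x 0), ∀ m, Tendsto (fun k => z k m) U (𝓝 y) := by
  have hlim : ∀ m, ∃ y ∈ levelSet f b l u (x 0), Tendsto (fun k => z k m) U (𝓝 y) := by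
    intro m
    obtain ⟨y, hy, hle⟩ := hcpt.ultrafilter_le_nhds (U.map fun k => z k m)
      (le_principal_iff.2 (U.mem_map.2 (univ_mem' fun k => hrun.mem_levelSet hcyc k m)))
    exact ⟨y, hy, hle⟩
  choose Y hYmem hY using hlim
  have hval : ∀ m, f (Y m) = v := fun m =>
    tendsto_nhds_unique ((hcont.tendsto _).comp (hY m)) (hv m)
  have hsucc : ∀ i : Fin n, Y i.succ = Y i.castSucc := by
    intro i
    by_contra hne
    have hle : f (Y i.succ) ≤ f (midpoint ℝ (Y i.succ) (Y i.castSucc)) := by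
      have hmid : Tendsto (fun k => midpoint ℝ (z k i.succ) (z k i.castSucc)) U
          (𝓝 (midpoint ℝ (Y i.succ) (Y i.castSucc))) := by
        simp only [midpoint_eq_smul_add]
        exact ((hY _).add (hY _)).const_smul _
      refine le_of_tendsto_of_tendsto' ((hcont.tendsto _).comp (hY _))
        ((hcont.tendsto _).comp hmid) fun k => ?_
      exact (hcyc k).step_min i ((convex_pairLine _ _ _).midpoint_mem ((hcyc k).step_mem i)
        (self_mem_pairLine ((hcyc k).mem _)))
    have hlt := hf.2 (Set.mem_univ (Y i.succ)) (Set.mem_univ (Y i.castSucc)) hne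
      (by norm_num : (0 : ℝ) < 1 / 2) (by norm_num : (0 : ℝ) < 1 / 2) (by norm_num)
    rw [midpoint_eq_smul_add, smul_add, hval] at hle
    simp only [hval, smul_eq_mul] at hlt
    norm_num at hlt hle
    linarith
  have hconst : ∀ m, Y m = Y 0 := by
    intro m
    induction m using Fin.induction with
    | zero => rfl
    | succ i ih => rw [hsucc, ih]
  exact ⟨Y 0, hYmem 0, fun m => hconst m ▸ hY m⟩

/-- An index that is admissible along a sequence tending to a point with an interior coordinate
is itself an interior coordinate of the limit. -/
theorem interior_of_admissible (hτ0 : 0 < τ) (U : Ultrafilter ℕ) {j₀ : Fin n}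
    {y : EuclideanSpace ℝ (Fin n)} (hx : Tendsto x U (𝓝 y))
    (hadm : ∀ᶠ k in (U : Filter ℕ), Admissible l u τ (x k) j₀)
    (hint : ∃ i, l i < (y i : EReal) ∧ (y i : EReal) < u i) :
    l j₀ < (y j₀ : EReal) ∧ (y j₀ : EReal) < u j₀ := by
  have hxi : ∀ i, Tendsto (fun k => x k i) U (𝓝 (y i)) := fun i =>
    ((by fun_prop : Continuous fun w : EuclideanSpace ℝ (Fin n) => w i).tendsto y).comp hx
  obtain ⟨i, hli, hui⟩ := hint
  obtain ⟨a, hla, hay⟩ := EReal.lt_iff_exists_real_btwn.1 hli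
  obtain ⟨c, hyc, hcu⟩ := EReal.lt_iff_exists_real_btwn.1 hui
  rw [EReal.coe_lt_coe_iff] at hay hyc
  obtain ⟨δ, hδ0, hδ⟩ : ∃ δ > 0, δ < min (y i - a) (c - y i) :=
    exists_between (lt_min (sub_pos.2 hay) (sub_pos.2 hyc))
  rw [lt_min_iff] at hδ
  have hev : ∀ᶠ k in (U : Filter ℕ), (δ : EReal) ≤ boundDist l u i (x k) := by
    filter_upwards [(hxi i).eventually_const_lt (by linarith : a + δ < y i),
      (hxi i).eventually_lt_const (by linarith : y i < c - δ)] with k h1 h2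
    exact coe_le_boundDist_iff.2 ⟨hla.le.trans (EReal.coe_le_coe_iff.2 (by linarith)),
      le_trans (EReal.coe_le_coe_iff.2 (by linarith)) hcu.le⟩
  have hevj : ∀ᶠ k in (U : Filter ℕ), l j₀ ≤ ((x k j₀ - τ * δ : ℝ) : EReal) ∧
      ((x k j₀ + τ * δ : ℝ) : EReal) ≤ u j₀ := by
    filter_upwards [hev, hadm] with k h1 h2
    refine coe_le_boundDist_iff.1 (le_trans ?_ h2)
    rw [EReal.coe_mul]
    exact mul_le_mul_of_nonneg_left
      (h1.trans (le_iSup (fun h => boundDist l u h (x k)) i)) (EReal.coe_nonneg.2 hτ0.le)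
  have hτδ : 0 < τ * δ := mul_pos hτ0 hδ0
  have hl : l j₀ ≤ ((y j₀ - τ * δ : ℝ) : EReal) :=
    ge_of_tendsto ((continuous_coe_real_ereal.tendsto _).comp ((hxi j₀).sub_const _))
      (hevj.mono fun _ h => h.1)
  have hu : ((y j₀ + τ * δ : ℝ) : EReal) ≤ u j₀ :=
    le_of_tendsto ((continuous_coe_real_ereal.tendsto _).comp ((hxi j₀).add_const _))
      (hevj.mono fun _ h => h.2)
  exact ⟨hl.trans_lt (EReal.coe_lt_coe_iff.2 (by linarith)),
    lt_of_lt_of_le (EReal.coe_lt_coe_iff.2 (by linarith)) hu⟩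

/-- Eventually the fixed index stays off its bounds during the whole outer iteration, and all
inner iterates approach the minimizer. -/
theorem IsRun.eventually_interior_and_mem (hrun : IsRun f b l u τ x j p z α)
    (hcyc : ∀ k, IsExactCycle f b l u (j k) (p k) (z k)) (hτ0 : 0 < τ)
    (hinterior : ∀ y ∈ levelSet f b l u (x 0),
      ∃ i, l i < (y i : EReal) ∧ (y i : EReal) < u i)
    (hf : StrictConvexOn ℝ Set.univ f) (hC2 : ContDiff ℝ 2 f)
    {xs : EuclideanSpace ℝ (Fin n)} (hxs : xs ∈ feasibleSet b l u)
    (hmin : IsMinOn f (feasibleSet b l u) xs) {N : Set (EuclideanSpace ℝ (Fin n))}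
    (hN : N ∈ 𝓝 xs) :
    ∀ᶠ k in atTop, (∀ m, l (j k) < (z k m (j k) : EReal) ∧ (z k m (j k) : EReal) < u (j k)) ∧
      ∀ m, z k m ∈ N := by
  have hd : Differentiable ℝ f := hC2.differentiable (by norm_num)
  have hcpt : IsCompact (levelSet f b l u (x 0)) :=
    isCompact_sublevel hf hC2.continuous convex_feasibleSet isClosed_feasibleSet hxs hmin _
  obtain ⟨v, hv⟩ := hrun.exists_tendsto hcyc (c := f xs) fun k => by
    rw [← hrun.inner_start]; exact hmin (hrun.mem_feasibleSet k 0)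
  refine mem_iff_ultrafilter.2 fun U hU => ?_
  obtain ⟨y, hy, hzy⟩ := hrun.exists_tendsto_ultrafilter hcyc hf hC2.continuous hcpt U
    fun m => (hv m).mono_left hU
  obtain ⟨⟨j₀, π⟩, hjp⟩ := Ultrafilter.eventually_exists_iff.1
    (Eventually.of_forall (f := (U : Filter ℕ)) fun k =>
      (⟨(j k, p k), rfl⟩ : ∃ c : Fin n × Equiv.Perm (Fin n), (j k, p k) = c))
  have hx : Tendsto x U (𝓝 y) := by
    have := hzy 0
    simpa only [hrun.inner_start] using this
  have hyint : l j₀ < (y j₀ : EReal) ∧ (y j₀ : EReal) < u j₀ := by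
    refine interior_of_admissible hτ0 U hx ?_ (hinterior y hy)
    filter_upwards [hjp] with k hk
    obtain ⟨rfl, -⟩ := Prod.mk.inj hk
    exact hrun.index_admissible k
  have hint : ∀ᶠ k in (U : Filter ℕ), ∀ m,
      l (j k) < (z k m (j k) : EReal) ∧ (z k m (j k) : EReal) < u (j k) := by
    have h1 : ∀ᶠ k in (U : Filter ℕ), ∀ m, ((z k m j₀ : ℝ) : EReal) ∈ Set.Ioo (l j₀) (u j₀) := by
      refine eventually_all.2 fun m => ?_
      have hc : Continuous fun w : EuclideanSpace ℝ (Fin n) => ((w j₀ : ℝ) : EReal) :=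
        continuous_coe_real_ereal.comp (by fun_prop)
      exact ((hc.tendsto y).comp (hzy m)) (isOpen_Ioo.mem_nhds hyint)
    filter_upwards [h1, hjp] with k hk hk'
    obtain ⟨rfl, -⟩ := Prod.mk.inj hk'
    exact hk
  have hkkt : ∀ q : Fin n, ∀ t : ℝ, l q ≤ (t : EReal) → (t : EReal) ≤ u q →
      gradDiff f q j₀ y * (t - y q) ≤ 0 := by
    intro q t hlt htu
    obtain ⟨i, rfl⟩ := π.surjective q
    have hc : Continuous fun w : EuclideanSpace ℝ (Fin n) =>
        gradDiff f (π i) j₀ w * (t - w (π i)) :=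
      (continuous_gradDiff hC2 _ _).mul (by fun_prop)
    refine le_of_tendsto ((hc.tendsto y).comp (hzy i.succ)) ?_
    filter_upwards [hint, hjp] with k hk hk'
    obtain ⟨rfl, rfl⟩ := Prod.mk.inj hk'
    exact (hcyc k).gradDiff_succ_mul_sub_nonpos hd hk i hlt htu
  have hymin : IsMinOn f (feasibleSet b l u) y := by
    intro w hw
    change f y ≤ f w
    have hs : ∑ i, (w - y) i = 0 := by
      simp only [PiLp.sub_apply, Finset.sum_sub_distrib, hw.1, hy.1.1, sub_self]
    have h1 := fderiv_apply_of_sum_eq_zero (f := f) j₀ y _ hs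
    have h2 : ∑ q, gradDiff f q j₀ y * (w - y) q ≤ 0 :=
      Finset.sum_nonpos fun q _ => hkkt q _ (hw.2 q).1 (hw.2 q).2
    have h3 := add_fderiv_le_of_convexOn hf.convexOn (hd y) w
    linarith
  obtain rfl : y = xs := (hf.subset (Set.subset_univ _) convex_feasibleSet).eq_of_isMinOn
    hymin hmin hy.1 hxs
  exact hint.and (eventually_all.2 fun m => hzy m hN)

end Run

end AC2CD

theorem theorem5 {n : ℕ} (f : EuclideanSpace ℝ (Fin n) → ℝ) (b : ℝ) (l u : Fin n → EReal)
    (hlu : ∀ i, l i < u i)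
    (τ : ℝ) (hτ0 : 0 < τ) (hτ1 : τ < 1)
    (x : ℕ → EuclideanSpace ℝ (Fin n)) (j : ℕ → Fin n) (p : ℕ → Equiv.Perm (Fin n))
    (z : ℕ → Fin (n + 1) → EuclideanSpace ℝ (Fin n)) (α : ℕ → Fin n → ℝ)
    (hrun : AC2CD.IsRun f b l u τ x j p z α)
    (hsticky : ∃ k₀ : ℕ, 1 ≤ k₀ ∧ ∀ k, k₀ ≤ k → AC2CD.StickyAt l u τ x j k)
    (hexact : ∀ k i, AC2CD.IsExactStep f l u (p k i) (j k) (z k i.castSucc) (α k i))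
    (hinterior : ∀ y ∈ AC2CD.levelSet f b l u (x 0),
      ∃ i, l i < (y i : EReal) ∧ (y i : EReal) < u i)
    (hconv : StrictConvexOn ℝ Set.univ f) (hC2 : ContDiff ℝ 2 f)
    (xs : EuclideanSpace ℝ (Fin n)) (hxs : xs ∈ AC2CD.feasibleSet b l u)
    (hmin : IsMinOn f (AC2CD.feasibleSet b l u) xs)
    (hhess : (AC2CD.hessian f xs).PosDef) :
    ∃ C : ℝ, 0 ≤ C ∧ C < 1 ∧ ∃ kbar : ℕ, ∀ k, kbar ≤ k →
      f (x (k + 1)) - f xs ≤ C * (f (x k) - f xs) := by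
  have hd : Differentiable ℝ f := hC2.differentiable (by norm_num)
  have hcyc := hrun.isExactCycle hexact hconv.convexOn hd
  have hstrict : HasStrictFDerivAt (fderiv ℝ f) (fderiv ℝ (fderiv ℝ f) xs) xs :=
    (hC2.contDiffAt.fderiv_right (m := 1) (by norm_num)).hasStrictFDerivAt (by norm_num)
  obtain ⟨μ, hμ, M, hM, r, hr, hball⟩ := AC2CD.exists_ball_stronglyMonotone_lipschitz hstrict
    fun v hv => AC2CD.fderiv_fderiv_pos_of_posDef hC2 hhess hv
  obtain ⟨kbar, hk⟩ := Filter.eventually_atTop.1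
    (hrun.eventually_interior_and_mem hcyc hτ0 hinterior hconv hC2 hxs hmin
      (Metric.ball_mem_nhds xs hr))
  set K : ℝ := (4 * n ^ 2 * M) ^ 2 * 4 / μ ^ 2 with hK
  have hK0 : 0 ≤ K := by positivity
  refine ⟨K / (1 + K), by positivity, (div_lt_one (by positivity)).2 (by linarith), kbar,
    fun k hkk => ?_⟩
  have h := (hcyc k).sub_le_mul_sub hconv.convexOn hd hxs hmin hμ hM hball (hk k hkk).2
    (hk k hkk).1
  rw [← hrun.inner_end, hrun.inner_start, ← hK] at h
  rw [div_mul_eq_mul_div, le_div_iff₀ (by positivity)]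
  linarith
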